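/- Let $X_1,\dots,X_n$ be real random variables on a probability space $(\Omega,\Sigma,\mathbb P)$. For an event $U$ with $\mathbb P[U]>0$ let $\mathrm{sd}_U(X_i)$ and $\mathrm{cov}_U(X_i,X_j)$ denote the standard deviation and the covariance with respect to the conditional probability $\mathbb P[\,\cdot\,|U]$, and let $\Sigma_U$ be the conditional correlation matrix, i.e. the $n\times n$ matrix with entries $$\Sigma_U[i,j]=\frac{\mathrm{cov}_U(X_i,X_j)}{\mathrm{sd}_U(X_i)\,\mathrm{sd}_U(X_j)},$$ where $\Sigma_U[i,j]:=\delta_{ij}$ (Kronecker delta) if $\mathrm{sd}_U(X_i)=0$ or $\mathrm{sd}_U(X_j)=0$. Let $\mathcal K=\{[a,b]\colon a<b\}$ be the family of compact intervals with distinct real endpoints. Then the following conditions are equivalent: 1. $X_1,\dots,X_n$ are mutually independent, i.e. $\mathbb P_{(X_1,\dots,X_n)}=\mathbb P_{X_1}\otimes\dots\otimes\mathbb P_{X_n}$; 2. $\Sigma_U=I_n$ for every event $U=\{X_1\in A_1,\dots,X_n\in A_n\}$ such that $A_1,\dots,A_n\in\mathcal K$ and $\mathbb P[U]>0$. If moreover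 $X_1,\dots,X_n$ have finite second moments, then the equivalence also holds with $\mathcal K$ replaced by the family of half-lines $\{[t,\infty)\colon t\in\mathbb R\}$. -/

import Mathlib

open MeasureTheory ProbabilityTheory

noncomputable section

namespace CondCorr

variable {Ω : Type*} [MeasurableSpace Ω]

/-- The standard deviation of a real random variable `X` under `μ`. -/
def stdDev (X : Ω → ℝ) (μ : Measure Ω) : ℝ :=
  Real.sqrt (variance X μ)

/-- Pearson's correlation of two real random variables under `μ`
(meaningful when both standard deviations are nonzero). -/
def correlation (X Y : Ω → ℝ) (μ : Measure Ω) : ℝ :=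
  covariance X Y μ / (stdDev X μ * stdDev Y μ)

/-- The event `{X₁ ∈ A₁, …, Xₙ ∈ Aₙ}`. -/
def boxEvent {n : ℕ} (X : Fin n → Ω → ℝ) (A : Fin n → Set ℝ) : Set Ω :=
  {ω | ∀ i, X i ω ∈ A i}

/-- The correlation matrix of `X₁, …, Xₙ` under the conditional probability given `U`. An entry for
which one of the two conditional standard deviations vanishes is the Kronecker delta. -/
def condCorrMatrix {n : ℕ} (P : Measure Ω) (X : Fin n → Ω → ℝ) (U : Set Ω) :
    Matrix (Fin n) (Fin n) ℝ :=
  Matrix.of fun i j =>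
    if stdDev (X i) (cond P U) = 0 ∨ stdDev (X j) (cond P U) = 0 then
      (if i = j then 1 else 0)
    else correlation (X i) (X j) (cond P U)

/-- The family of compact intervals `[a, b]` with `a < b`. -/
def boundedIntervals : Set (Set ℝ) :=
  {A | ∃ a b : ℝ, a < b ∧ A = Set.Icc a b}

/-- The family of half-lines `[t, ∞)`. -/
def halfLines : Set (Set ℝ) :=
  {A | ∃ t : ℝ, A = Set.Ici t}

/-- For every choice of `A₁, …, Aₙ` in the family `𝒦` such that `U = {X₁ ∈ A₁, …, Xₙ ∈ Aₙ}` has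
positive probability, the conditional correlation matrix given `U` is the identity matrix. -/
def CorrMatrixEqOne {n : ℕ} (P : Measure Ω) (X : Fin n → Ω → ℝ) (𝒦 : Set (Set ℝ)) : Prop :=
  ∀ A : Fin n → Set ℝ, (∀ i, A i ∈ 𝒦) → 0 < P (boxEvent X A) →
    condCorrMatrix P X (boxEvent X A) = 1

end CondCorr

end

/-!
Independence implies uncorrelatedness given a box, because conditioning on a box preserves
independence (`CondCorr.CorrMatrixEqOne.of_iIndepFun`).

For the converse, consider first two square integrable variables `X`, `Y` that are uncorrelated
given every quadrant `{X ≥ -u, Y ≥ -v}` of positive probability. Put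
`H(u, v) = E[(X + u)⁺ (Y + v)⁺]`. Its right derivatives `M = H_u`, `N = H_v`, `G = H_uv` are
obtained by replacing positive parts by indicator functions, so that `G(u, v)` is the probability of
the quadrant, and since covariances are shift invariant, the hypothesis says precisely
`G H = M N`, that is `∂_u ∂_v log H = 0` (`CondCorr.quadrant_mul_eq_mul`). Hence the `2 × 2` minors
of `H` vanish (`CondCorr.minor_eq_zero_of_le`), and by differentiation in all four variables so do
those of `G` (`CondCorr.mixed_deriv_minor_eq_zero`). Sending one corner to infinity gives the
factorization of `P(X ≥ a, Y ≥ b)` (`CondCorr.measureReal_tail_inter_eq_mul`).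

For `n` variables, the two-variable result is applied under the conditional probability given a box
with large sides in the family (`CondCorr.box_tail_mul_eq_mul`). As the sides increase to half-lines
`[t k, ∞)` for `k ∈ S` and to `ℝ` for the other `k`, this shows that any two further variables have
independent tails given `{X k ≥ t k for k ∈ S}`. Induction on `S` factorizes the probabilities of all
such events, and these form generating π-systems (`CondCorr.CorrMatrixEqOne.iIndepFun`). Bounded
intervals and half-lines are treated alike: all that matters is that they contain an exhaustion of
`ℝ` whose members remain in the family, or become trivial, when cut off from the left.
-/

open Filter Topology Set

namespace CondCorr

/-! ### Product form from a partial differential equation -/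

/-- If `f' / f = g' / g` for the right derivatives on an interval where `g` does not vanish, then
`f / g` takes the same value at both end points. -/
lemma mul_eq_mul_of_right_deriv {f g f' g' : ℝ → ℝ} {a b : ℝ} (hab : a ≤ b)
    (hf : ContinuousOn f (Icc a b)) (hg : ContinuousOn g (Icc a b))
    (hf' : ∀ x ∈ Ico a b, HasDerivWithinAt f (f' x) (Ici x) x)
    (hg' : ∀ x ∈ Ico a b, HasDerivWithinAt g (g' x) (Ici x) x)
    (hpos : ∀ x ∈ Icc a b, 0 < g x) (h : ∀ x ∈ Ico a b, f' x * g x = f x * g' x) :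
    f b * g a = f a * g b := by
  have key := constant_of_has_deriv_right_zero (f := fun x => f x / g x)
    (hf.div hg fun x hx => (hpos x hx).ne') (fun x hx => by
      have := (hf' x hx).div (hg' x hx) (hpos x (Ico_subset_Icc_self hx)).ne'
      rwa [h x hx, sub_self, zero_div] at this) b (right_mem_Icc.2 hab)
  rwa [div_eq_div_iff (hpos b (right_mem_Icc.2 hab)).ne' (hpos a (left_mem_Icc.2 hab)).ne'] at key

/-- A nonnegative solution `H` of `H_uv * H = H_u * H_v` that is monotone in both arguments is of
product form: its `2 × 2` minors vanish. Where `H > 0` the equation makes `H_u / H` constant in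
`v`, so that `H(·, v₁) / H(·, v₀)` is constant; the intermediate value theorem excludes that `H`
vanishes at a corner of a rectangle while the product of the two adjacent corners is positive. -/
lemma minor_eq_zero_of_le {H M N G : ℝ → ℝ → ℝ}
    (hHu : ∀ u v, HasDerivWithinAt (fun x => H x v) (M u v) (Ici u) u)
    (hHv : ∀ u v, HasDerivWithinAt (fun y => H u y) (N u v) (Ici v) v)
    (hMv : ∀ u v, HasDerivWithinAt (fun y => M u y) (G u v) (Ici v) v)
    (cHu : ∀ v, Continuous fun x => H x v) (cHv : ∀ u, Continuous fun y => H u y)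
    (cMv : ∀ u, Continuous fun y => M u y)
    (hH0 : ∀ u v, 0 ≤ H u v) (mHu : ∀ v, Monotone fun x => H x v)
    (mHv : ∀ u, Monotone fun y => H u y)
    (hGH : ∀ u v, G u v * H u v = M u v * N u v)
    {u₀ u₁ v₀ v₁ : ℝ} (hu : u₀ ≤ u₁) (hv : v₀ ≤ v₁) :
    H u₁ v₁ * H u₀ v₀ = H u₀ v₁ * H u₁ v₀ := by
  have hM : ∀ u, 0 < H u v₀ → M u v₁ * H u v₀ = M u v₀ * H u v₁ := fun u hpos =>
    mul_eq_mul_of_right_deriv hv (cMv u).continuousOn (cHv u).continuousOn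
      (fun y _ => hMv u y) (fun y _ => hHv u y)
      (fun y hy => hpos.trans_le (mHv u hy.1)) (fun y _ => hGH u y)
  have hpos : ∀ u, u ≤ u₁ → 0 < H u v₀ → H u₁ v₁ * H u v₀ = H u v₁ * H u₁ v₀ := by
    intro u huu hp
    refine mul_eq_mul_of_right_deriv huu (cHu v₁).continuousOn (cHu v₀).continuousOn
      (fun x _ => hHu x v₁) (fun x _ => hHu x v₀)
      (fun x hx => hp.trans_le (mHu v₀ hx.1)) (fun x hx => ?_)
    rw [hM x (hp.trans_le (mHu v₀ hx.1)), mul_comm]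
  rcases (hH0 u₀ v₀).lt_or_eq with h0 | h0
  · exact hpos u₀ hu h0
  rw [← h0, mul_zero]
  by_contra hne
  have hA : 0 < H u₀ v₁ := (hH0 _ _).lt_of_ne fun h => hne (by rw [← h, zero_mul])
  have hB : 0 < H u₁ v₀ := (hH0 _ _).lt_of_ne fun h => hne (by rw [← h, mul_zero])
  have hC : 0 < H u₁ v₁ := hA.trans_le (mHu v₁ hu)
  -- a positive value of `H(·, v₀)` is at least `H(u₀, v₁) H(u₁, v₀) / H(u₁, v₁)`, so half of this
  -- bound is not attained
  set ε := H u₀ v₁ * H u₁ v₀ / (2 * H u₁ v₁) with hε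
  have hε0 : 0 < ε := by positivity
  have hεB : ε ≤ H u₁ v₀ := by
    rw [hε, div_le_iff₀ (by positivity)]
    have : H u₀ v₁ ≤ H u₁ v₁ := mHu v₁ hu
    nlinarith
  obtain ⟨u, ⟨hu1, hu2⟩, hval⟩ := intermediate_value_Icc hu (cHu v₀).continuousOn
    (show ε ∈ Icc (H u₀ v₀) (H u₁ v₀) from ⟨h0 ▸ hε0.le, hεB⟩)
  simp only at hval
  have h1 := hpos u hu2 (hval ▸ hε0)
  have h2 : H u₀ v₁ ≤ H u v₁ := mHu v₁ hu1
  have h3 : H u₁ v₁ * ε * 2 = H u₀ v₁ * H u₁ v₀ := by rw [hε]; field_simp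
  rw [hval] at h1
  nlinarith [mul_pos hA hB]

/-- The product form of a solution `H` of `H_uv * H = H_u * H_v` passes to `H_uv`, by
differentiating the vanishing minors in each of the four variables. -/
lemma mixed_deriv_minor_eq_zero {H M N G : ℝ → ℝ → ℝ}
    (hHu : ∀ u v, HasDerivWithinAt (fun x => H x v) (M u v) (Ici u) u)
    (hHv : ∀ u v, HasDerivWithinAt (fun y => H u y) (N u v) (Ici v) v)
    (hMv : ∀ u v, HasDerivWithinAt (fun y => M u y) (G u v) (Ici v) v)
    (hNu : ∀ u v, HasDerivWithinAt (fun x => N x v) (G u v) (Ici u) u)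
    (cHu : ∀ v, Continuous fun x => H x v) (cHv : ∀ u, Continuous fun y => H u y)
    (cMv : ∀ u, Continuous fun y => M u y)
    (hH0 : ∀ u v, 0 ≤ H u v) (mHu : ∀ v, Monotone fun x => H x v)
    (mHv : ∀ u, Monotone fun y => H u y)
    (hGH : ∀ u v, G u v * H u v = M u v * N u v) (u₀ u₁ v₀ v₁ : ℝ) :
    G u₁ v₁ * G u₀ v₀ = G u₀ v₁ * G u₁ v₀ := by
  have key : ∀ {u₀ u₁ v₀ v₁}, u₀ ≤ u₁ → v₀ ≤ v₁ →
      H u₁ v₁ * H u₀ v₀ = H u₀ v₁ * H u₁ v₀ := fun hu hv =>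
    minor_eq_zero_of_le hHu hHv hMv cHu cHv cMv hH0 mHu mHv hGH hu hv
  have h0 : ∀ u₀ u₁ v₀ v₁, H u₁ v₁ * H u₀ v₀ = H u₀ v₁ * H u₁ v₀ := by
    intro u₀ u₁ v₀ v₁
    rcases le_total u₀ u₁ with hu | hu <;> rcases le_total v₀ v₁ with hv | hv
    · exact key hu hv
    · linarith [key hu hv]
    · linarith [key hu hv]
    · linarith [key hu hv]
  have uniq : ∀ {f g : ℝ → ℝ} {f' g' x : ℝ}, (∀ x, f x = g x) →
      HasDerivWithinAt f f' (Ici x) x → HasDerivWithinAt g g' (Ici x) x → f' = g' := by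
    intro f g f' g' x hfg hf hg
    obtain rfl : f = g := funext hfg
    exact (uniqueDiffWithinAt_Ici x).eq_deriv _ hf hg
  have h1 : ∀ u₀ u₁ v₀ v₁, M u₁ v₁ * H u₀ v₀ = H u₀ v₁ * M u₁ v₀ := fun u₀ u₁ v₀ v₁ =>
    uniq (fun u => h0 u₀ u v₀ v₁) ((hHu u₁ v₁).mul_const _) ((hHu u₁ v₀).const_mul _)
  have h2 : ∀ u₀ u₁ v₀ v₁, G u₁ v₁ * H u₀ v₀ = N u₀ v₁ * M u₁ v₀ := fun u₀ u₁ v₀ v₁ =>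
    uniq (fun v => h1 u₀ u₁ v₀ v) ((hMv u₁ v₁).mul_const _) ((hHv u₀ v₁).mul_const _)
  have h3 : ∀ u₀ u₁ v₀ v₁, G u₁ v₁ * M u₀ v₀ = G u₀ v₁ * M u₁ v₀ := fun u₀ u₁ v₀ v₁ =>
    uniq (fun u => h2 u u₁ v₀ v₁) ((hHu u₀ v₀).const_mul _) ((hNu u₀ v₁).mul_const _)
  exact uniq (fun v => h3 u₀ u₁ v v₁) ((hMv u₀ v₀).const_mul _) ((hMv u₁ v₀).const_mul _)

/-! ### Truncated moments and quadrant probabilities -/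

section

/-- The positive part `(x + u)⁺`. -/
noncomputable def ramp (u x : ℝ) : ℝ := max (x + u) 0

/-- The indicator function of `x + u ≥ 0`, the right derivative of `ramp u x` in `u`. -/
noncomputable def step (u x : ℝ) : ℝ := if 0 ≤ x + u then 1 else 0

lemma measurable_ramp (u : ℝ) : Measurable (ramp u) := by
  unfold ramp; fun_prop

lemma measurable_step (u : ℝ) : Measurable (step u) :=
  Measurable.ite (measurableSet_le measurable_const (by fun_prop)) measurable_const
    measurable_const

lemma ramp_nonneg (u x : ℝ) : 0 ≤ ramp u x := le_max_right _ _

lemma step_nonneg (u x : ℝ) : 0 ≤ step u x := by unfold step; split_ifs <;> norm_num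

lemma step_le_one (u x : ℝ) : step u x ≤ 1 := by unfold step; split_ifs <;> norm_num

lemma ramp_mono {u v : ℝ} (h : u ≤ v) (x : ℝ) : ramp u x ≤ ramp v x :=
  max_le_max_right 0 (by linarith)

lemma abs_ramp_sub_ramp_le (u v x : ℝ) : |ramp u x - ramp v x| ≤ |u - v| := by
  have := abs_max_sub_max_le_abs (x + u) (x + v) 0
  rwa [add_sub_add_left_eq_sub] at this

lemma hasDerivWithinAt_ramp (u x : ℝ) :
    HasDerivWithinAt (fun v => ramp v x) (step u x) (Ici u) u := by
  unfold step ramp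
  split_ifs with h
  · refine ((hasDerivWithinAt_id u (Ici u)).const_add x).congr (fun v hv => ?_) ?_
    · exact max_eq_left (by linarith [mem_Ici.1 hv])
    · exact max_eq_left h
  · push Not at h
    refine HasDerivAt.hasDerivWithinAt ?_
    refine (hasDerivAt_const u (0 : ℝ)).congr_of_eventuallyEq ?_
    filter_upwards [eventually_lt_nhds (show u < -x by linarith)] with v hv
    exact max_eq_right (by linarith)

variable {Ω : Type*} [MeasurableSpace Ω] {μ : Measure Ω} {W X Y : Ω → ℝ}

lemma hasDerivWithinAt_integral_mul_ramp (hX : Measurable X) (hW : Integrable W μ)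
    (hWX : ∀ u, Integrable (fun ω => W ω * ramp u (X ω)) μ) (u : ℝ) :
    HasDerivWithinAt (fun v => ∫ ω, W ω * ramp v (X ω) ∂μ) (∫ ω, W ω * step u (X ω) ∂μ)
      (Ici u) u := by
  rw [hasDerivWithinAt_iff_tendsto_slope, Ici_sdiff_left]
  have h : ∀ v, slope (fun v => ∫ ω, W ω * ramp v (X ω) ∂μ) u v
      = ∫ ω, W ω * slope (fun v => ramp v (X ω)) u v ∂μ := by
    intro v
    simp only [slope_def_field]
    rw [← integral_sub (hWX v) (hWX u), ← integral_div]
    congr with ω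
    ring
  rw [show slope _ u = _ from funext h]
  refine tendsto_integral_filter_of_dominated_convergence (fun ω => |W ω|) ?_ ?_ hW.abs ?_
  · refine Eventually.of_forall fun v => hW.1.mul ?_
    simp only [slope_def_field]
    exact ((((measurable_ramp v).comp hX).sub ((measurable_ramp u).comp hX)).div_const
      _).aestronglyMeasurable
  · refine Eventually.of_forall fun v => ae_of_all _ fun ω => ?_
    rw [Real.norm_eq_abs, abs_mul, slope_def_field, abs_div]
    exact mul_le_of_le_one_right (abs_nonneg _)
      (div_le_one_of_le₀ (abs_ramp_sub_ramp_le _ _ _) (abs_nonneg _))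
  · refine ae_of_all _ fun ω => Tendsto.const_mul _ ?_
    have := hasDerivWithinAt_ramp u (X ω)
    rwa [hasDerivWithinAt_iff_tendsto_slope, Ici_sdiff_left] at this

lemma continuous_integral_mul_ramp (hW : Integrable W μ)
    (hWX : ∀ u, Integrable (fun ω => W ω * ramp u (X ω)) μ) :
    Continuous fun v => ∫ ω, W ω * ramp v (X ω) ∂μ := by
  refine (LipschitzWith.of_dist_le' (K := ∫ ω, |W ω| ∂μ) fun u v => ?_).continuous
  rw [Real.dist_eq, Real.dist_eq, ← integral_sub (hWX u) (hWX v), ← integral_mul_const]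
  refine (abs_integral_le_integral_abs).trans (integral_mono ((hWX u).sub (hWX v)).abs
    (hW.abs.mul_const _) fun ω => ?_)
  simp only [← mul_sub, abs_mul]
  exact mul_le_mul_of_nonneg_left (abs_ramp_sub_ramp_le _ _ _) (abs_nonneg _)

lemma memLp_step [IsFiniteMeasure μ] (hX : Measurable X) (u : ℝ) :
    MemLp (fun ω => step u (X ω)) 2 μ := by
  refine MemLp.of_bound ((measurable_step u).comp hX).aestronglyMeasurable 1
    (ae_of_all _ fun ω => ?_)
  rw [Real.norm_eq_abs, abs_of_nonneg (step_nonneg _ _)]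
  exact step_le_one _ _

lemma memLp_ramp [IsFiniteMeasure μ] (hX : Measurable X) (h2 : MemLp X 2 μ) (u : ℝ) :
    MemLp (fun ω => ramp u (X ω)) 2 μ := by
  refine (h2.add (memLp_const u)).mono ((measurable_ramp u).comp hX).aestronglyMeasurable
    (ae_of_all _ fun ω => ?_)
  simp only [Pi.add_apply, Real.norm_eq_abs, ramp]
  exact (abs_of_nonneg (le_max_right _ _)).trans_le (max_le (le_abs_self _) (abs_nonneg _))

/-- The upper right quadrant `{X ≥ -u, Y ≥ -v}`. -/
def quadrant (X Y : Ω → ℝ) (u v : ℝ) : Set Ω := {ω | 0 ≤ X ω + u ∧ 0 ≤ Y ω + v}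

lemma measurableSet_quadrant (hX : Measurable X) (hY : Measurable Y) (u v : ℝ) :
    MeasurableSet (quadrant X Y u v) :=
  (measurableSet_le measurable_const (hX.add_const u)).inter
    (measurableSet_le measurable_const (hY.add_const v))

lemma integral_step_mul_step (hX : Measurable X) (hY : Measurable Y) (u v : ℝ) :
    ∫ ω, step u (X ω) * step v (Y ω) ∂μ = μ.real (quadrant X Y u v) := by
  rw [← integral_indicator_one (measurableSet_quadrant hX hY u v)]
  congr with ω
  by_cases h1 : 0 ≤ X ω + u <;> by_cases h2 : 0 ≤ Y ω + v <;>
    simp [step, quadrant, indicator, h1, h2]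

/-- A vanishing conditional covariance on a quadrant, expressed through the truncated moments:
covariances are invariant under shifts, so that `X` and `Y` can be replaced by `X + u` and `Y + v`,
which are nonnegative on the quadrant. -/
lemma quadrant_mul_eq_mul [IsFiniteMeasure μ] (hX : Measurable X) (hY : Measurable Y)
    (hX2 : MemLp X 2 μ) (hY2 : MemLp Y 2 μ) (u v : ℝ)
    (hcov : μ (quadrant X Y u v) ≠ 0 → cov[X, Y; cond μ (quadrant X Y u v)] = 0) :
    (∫ ω, step u (X ω) * step v (Y ω) ∂μ) * (∫ ω, ramp u (X ω) * ramp v (Y ω) ∂μ) =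
      (∫ ω, step u (X ω) * ramp v (Y ω) ∂μ) * (∫ ω, ramp u (X ω) * step v (Y ω) ∂μ) := by
  set U := quadrant X Y u v with hU
  have hUm : MeasurableSet U := measurableSet_quadrant hX hY u v
  have e1 : ∫ ω, ramp u (X ω) * ramp v (Y ω) ∂μ = ∫ ω in U, (X ω + u) * (Y ω + v) ∂μ := by
    rw [← integral_indicator hUm]
    congr with ω
    by_cases h1 : 0 ≤ X ω + u <;> by_cases h2 : 0 ≤ Y ω + v <;>
      simp [ramp, U, quadrant, indicator, h1, h2, le_of_not_ge]
  have e2 : ∫ ω, step u (X ω) * ramp v (Y ω) ∂μ = ∫ ω in U, (Y ω + v) ∂μ := by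
    rw [← integral_indicator hUm]
    congr with ω
    by_cases h1 : 0 ≤ X ω + u <;> by_cases h2 : 0 ≤ Y ω + v <;>
      simp [ramp, step, U, quadrant, indicator, h1, h2, le_of_not_ge]
  have e3 : ∫ ω, ramp u (X ω) * step v (Y ω) ∂μ = ∫ ω in U, (X ω + u) ∂μ := by
    rw [← integral_indicator hUm]
    congr with ω
    by_cases h1 : 0 ≤ X ω + u <;> by_cases h2 : 0 ≤ Y ω + v <;>
      simp [ramp, step, U, quadrant, indicator, h1, h2, le_of_not_ge]
  rw [e1, e2, e3, integral_step_mul_step hX hY]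
  by_cases h0 : μ U = 0
  · simp [Measure.restrict_eq_zero.2 h0]
  have := cond_isProbabilityMeasure h0
  have hc := hcov h0
  have mem : ∀ {Z : Ω → ℝ}, MemLp Z 2 μ → MemLp Z 2 (cond μ U) := fun hZ =>
    (hZ.restrict U).smul_measure (ENNReal.inv_ne_top.2 h0)
  have hXc := mem hX2
  have hYc := mem hY2
  have hsub := covariance_eq_sub (μ := cond μ U) (hXc.add (memLp_const u)) (hYc.add (memLp_const v))
  have hshift : cov[X + fun _ => u, Y + fun _ => v; cond μ U] = 0 := by
    rw [← hc]
    exact (covariance_add_const_left (hXc.integrable (by norm_num)) u).trans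
      (covariance_add_const_right (hYc.integrable (by norm_num)) v)
  have hint : ∀ f : Ω → ℝ, ∫ ω, f ω ∂(cond μ U) = (μ.real U)⁻¹ * ∫ ω in U, f ω ∂μ := by
    intro f
    rw [ProbabilityTheory.cond, integral_smul_measure, ENNReal.toReal_inv, smul_eq_mul, Measure.real]
  rw [hshift, hint, hint, hint] at hsub
  have hr : μ.real U ≠ 0 := by simpa [measureReal_eq_zero_iff] using h0
  simp only [Pi.mul_apply, Pi.add_apply] at hsub
  field_simp at hsub
  linarith

/-- If `X` and `Y` are uncorrelated given every quadrant of positive probability, then the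
probabilities of quadrants satisfy `G(u₁, v₁) G(u₀, v₀) = G(u₀, v₁) G(u₁, v₀)`. -/
lemma quadrant_minor_eq_zero [IsFiniteMeasure μ] (hX : Measurable X) (hY : Measurable Y)
    (hX2 : MemLp X 2 μ) (hY2 : MemLp Y 2 μ)
    (hcov : ∀ u v, μ (quadrant X Y u v) ≠ 0 → cov[X, Y; cond μ (quadrant X Y u v)] = 0)
    (u₀ u₁ v₀ v₁ : ℝ) :
    μ.real (quadrant X Y u₁ v₁) * μ.real (quadrant X Y u₀ v₀) =
      μ.real (quadrant X Y u₀ v₁) * μ.real (quadrant X Y u₁ v₀) := by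
  have rX := memLp_ramp hX hX2
  have rY := memLp_ramp hY hY2
  have sX := memLp_step (μ := μ) hX
  have sY := memLp_step (μ := μ) hY
  have int : ∀ {Z : Ω → ℝ}, MemLp Z 2 μ → Integrable Z μ := fun h => h.integrable (by norm_num)
  simp only [← integral_step_mul_step hX hY]
  refine mixed_deriv_minor_eq_zero
    (H := fun u v => ∫ ω, ramp u (X ω) * ramp v (Y ω) ∂μ)
    (M := fun u v => ∫ ω, step u (X ω) * ramp v (Y ω) ∂μ)
    (N := fun u v => ∫ ω, ramp u (X ω) * step v (Y ω) ∂μ)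
    (G := fun u v => ∫ ω, step u (X ω) * step v (Y ω) ∂μ)
    ?_ ?_ ?_ ?_ ?_ ?_ ?_ ?_ ?_ ?_ ?_ u₀ u₁ v₀ v₁
  · intro u v
    simp only [mul_comm _ (ramp v _)]
    exact hasDerivWithinAt_integral_mul_ramp hX (int (rY v))
      (fun u => (rY v).integrable_mul (rX u)) u
  · exact fun u v => hasDerivWithinAt_integral_mul_ramp hY (int (rX u))
      (fun v => (rX u).integrable_mul (rY v)) v
  · exact fun u v => hasDerivWithinAt_integral_mul_ramp hY (int (sX u))
      (fun v => (sX u).integrable_mul (rY v)) v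
  · intro u v
    simp only [mul_comm _ (step v _)]
    exact hasDerivWithinAt_integral_mul_ramp hX (int (sY v))
      (fun u => (sY v).integrable_mul (rX u)) u
  · intro v
    simp only [mul_comm _ (ramp v _)]
    exact continuous_integral_mul_ramp (int (rY v)) (fun u => (rY v).integrable_mul (rX u))
  · exact fun u => continuous_integral_mul_ramp (int (rX u)) fun v => (rX u).integrable_mul (rY v)
  · exact fun u => continuous_integral_mul_ramp (int (sX u)) fun v => (sX u).integrable_mul (rY v)
  · exact fun u v => integral_nonneg fun ω => mul_nonneg (ramp_nonneg _ _) (ramp_nonneg _ _)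
  · exact fun v u u' h => integral_mono ((rX u).integrable_mul (rY v))
      ((rX u').integrable_mul (rY v)) fun ω =>
        mul_le_mul_of_nonneg_right (ramp_mono h _) (ramp_nonneg _ _)
  · exact fun u v v' h => integral_mono ((rX u).integrable_mul (rY v))
      ((rX u).integrable_mul (rY v')) fun ω =>
        mul_le_mul_of_nonneg_left (ramp_mono h _) (ramp_nonneg _ _)
  · exact fun u v => quadrant_mul_eq_mul hX hY hX2 hY2 u v (hcov u v)

end

/-! ### Two variables, and the correlation matrix -/

section

variable {Ω : Type*} [MeasurableSpace Ω] {μ : Measure Ω} {X Y : Ω → ℝ}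

lemma tendsto_measureReal_iUnion [IsFiniteMeasure μ] {s : ℕ → Set Ω} (hs : Monotone s) :
    Tendsto (fun N => μ.real (s N)) atTop (𝓝 (μ.real (⋃ N, s N))) :=
  (ENNReal.tendsto_toReal (measure_ne_top _ _)).comp (tendsto_measure_iUnion_atTop hs)

/-- Uncorrelatedness on all upper right quadrants makes `X` and `Y` independent: the lower left
corner of the vanishing `2 × 2` minors of quadrant probabilities is sent to infinity. -/
lemma measureReal_tail_inter_eq_mul [IsProbabilityMeasure μ] (hX : Measurable X)
    (hY : Measurable Y) (hX2 : MemLp X 2 μ) (hY2 : MemLp Y 2 μ)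
    (hcov : ∀ a b, μ (X ⁻¹' Ici a ∩ Y ⁻¹' Ici b) ≠ 0 →
      cov[X, Y; ProbabilityTheory.cond μ (X ⁻¹' Ici a ∩ Y ⁻¹' Ici b)] = 0) (a b : ℝ) :
    μ.real (X ⁻¹' Ici a ∩ Y ⁻¹' Ici b) = μ.real (X ⁻¹' Ici a) * μ.real (Y ⁻¹' Ici b) := by
  have hq : ∀ u v, quadrant X Y u v = X ⁻¹' Ici (-u) ∩ Y ⁻¹' Ici (-v) := by
    intro u v
    ext ω
    simp [quadrant, neg_le_iff_add_nonneg]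
  have key := quadrant_minor_eq_zero hX hY hX2 hY2 (fun u v => by rw [hq]; exact hcov _ _)
  have mono : ∀ Z : Ω → ℝ, Monotone fun N : ℕ => Z ⁻¹' Ici (-(N : ℝ)) := fun Z M N h =>
    preimage_mono (Ici_subset_Ici.2 (neg_le_neg (Nat.cast_le.2 h)))
  have hex : ∀ Z : Ω → ℝ, ∀ ω, ∃ N : ℕ, -(N : ℝ) ≤ Z ω := fun Z ω => by
    obtain ⟨N, hN⟩ := exists_nat_ge (-Z ω)
    exact ⟨N, by linarith⟩
  have t1 := tendsto_measureReal_iUnion (μ := μ)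
    (s := fun N : ℕ => X ⁻¹' Ici (-(N : ℝ)) ∩ Y ⁻¹' Ici (-(N : ℝ)))
    (fun M N h => inter_subset_inter (mono X h) (mono Y h))
  have t2 := tendsto_measureReal_iUnion (μ := μ)
    (s := fun N : ℕ => X ⁻¹' Ici (-(N : ℝ)) ∩ Y ⁻¹' Ici b)
    (fun M N h => inter_subset_inter (mono X h) subset_rfl)
  have t3 := tendsto_measureReal_iUnion (μ := μ)
    (s := fun N : ℕ => X ⁻¹' Ici a ∩ Y ⁻¹' Ici (-(N : ℝ)))
    (fun M N h => inter_subset_inter subset_rfl (mono Y h))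
  have u1 : ⋃ N : ℕ, X ⁻¹' Ici (-(N : ℝ)) ∩ Y ⁻¹' Ici (-(N : ℝ)) = univ := by
    rw [iUnion_inter_of_monotone (mono X) (mono Y)]
    ext ω
    simpa using ⟨hex X ω, hex Y ω⟩
  have u2 : ⋃ N : ℕ, X ⁻¹' Ici (-(N : ℝ)) ∩ Y ⁻¹' Ici b = Y ⁻¹' Ici b := by
    ext ω
    simpa using fun _ => hex X ω
  have u3 : ⋃ N : ℕ, X ⁻¹' Ici a ∩ Y ⁻¹' Ici (-(N : ℝ)) = X ⁻¹' Ici a := by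
    ext ω
    simpa using fun _ => hex Y ω
  rw [u1, probReal_univ] at t1
  rw [u2] at t2
  rw [u3] at t3
  have := tendsto_nhds_unique ((t1.const_mul (μ.real (X ⁻¹' Ici a ∩ Y ⁻¹' Ici b))).congr
    fun N => ?_) (t2.mul t3)
  · rw [mul_one] at this
    rw [this, mul_comm]
  · have := key N (-a) N (-b)
    rw [hq, hq, hq, hq, neg_neg, neg_neg] at this
    exact this

lemma covariance_eq_zero_of_ae_const [IsProbabilityMeasure μ] {c : ℝ} (h : ∀ᵐ ω ∂μ, X ω = c) :
    cov[X, Y; μ] = 0 := by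
  have hm : ∫ ω, X ω ∂μ = c := by rw [integral_congr_ae h]; simp
  refine integral_eq_zero_of_ae ?_
  filter_upwards [h] with ω hω
  simp [hω, hm]

lemma stdDev_eq_zero_iff : stdDev X μ = 0 ↔ variance X μ = 0 := by
  rw [stdDev, Real.sqrt_eq_zero (variance_nonneg _ _)]

lemma covariance_eq_zero_of_stdDev_eq_zero [IsProbabilityMeasure μ] (hX : MemLp X 2 μ)
    (h : stdDev X μ = 0) : cov[X, Y; μ] = 0 :=
  covariance_eq_zero_of_ae_const (ae_eq_integral_of_variance_eq_zero hX (stdDev_eq_zero_iff.1 h))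

section Matrix

variable {n : ℕ} {P : Measure Ω} {X : Fin n → Ω → ℝ} {U : Set Ω}

/-- The conditional correlation matrix is the identity exactly if the variables are conditionally
pairwise uncorrelated; the convention for vanishing standard deviations is harmless, as constants
are uncorrelated with everything. -/
lemma condCorrMatrix_eq_one_iff [IsFiniteMeasure P] (hU : P U ≠ 0)
    (hX : ∀ i, MemLp (X i) 2 (cond P U)) :
    condCorrMatrix P X U = 1 ↔ ∀ i j, i ≠ j → cov[X i, X j; ProbabilityTheory.cond P U] = 0 := by
  have := cond_isProbabilityMeasure hU
  constructor
  · intro h i j hij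
    have hent := congrFun (congrFun h i) j
    rw [Matrix.one_apply_ne hij, condCorrMatrix, Matrix.of_apply] at hent
    split_ifs at hent with h0
    · rcases h0 with h0 | h0
      · exact covariance_eq_zero_of_stdDev_eq_zero (hX i) h0
      · rw [covariance_comm]
        exact covariance_eq_zero_of_stdDev_eq_zero (hX j) h0
    · push Not at h0
      rw [correlation, div_eq_zero_iff, mul_eq_zero] at hent
      tauto
  · intro h
    ext i j
    rw [condCorrMatrix, Matrix.of_apply, Matrix.one_apply]
    split_ifs with h0 hij hij
    · rfl
    · rfl
    · subst hij
      have hv : variance (X i) (ProbabilityTheory.cond P U) ≠ 0 := fun hv =>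
        h0 (Or.inl (stdDev_eq_zero_iff.2 hv))
      rw [correlation, stdDev, Real.mul_self_sqrt (variance_nonneg _ _),
        covariance_self (hX i).aemeasurable, div_self hv]
    · rw [correlation, h i j hij, zero_div]

lemma measurableSet_boxEvent (hX : ∀ i, Measurable (X i)) {A : Fin n → Set ℝ}
    (hA : ∀ i, MeasurableSet (A i)) : MeasurableSet (boxEvent X A) := by
  rw [boxEvent, Set.ofPred_forall]
  exact MeasurableSet.iInter fun i => hX i (hA i)

lemma memLp_cond_boxEvent {A : Fin n → Set ℝ} {i : Fin n} {B : Set ℝ} (hAB : A i ⊆ B)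
    (hL : MemLp (X i) 2 (P.restrict (X i ⁻¹' B))) (hU : P (boxEvent X A) ≠ 0) :
    MemLp (X i) 2 (cond P (boxEvent X A)) :=
  (hL.mono_measure (Measure.restrict_mono_set P
    (show boxEvent X A ⊆ X i ⁻¹' B from fun _ hω => hAB (hω i)))).smul_measure
    (ENNReal.inv_ne_top.2 hU)

/-- Independence survives conditioning on a box. -/
lemma CorrMatrixEqOne.of_iIndepFun [IsFiniteMeasure P] (hX : ∀ i, Measurable (X i))
    {𝒦 : Set (Set ℝ)} (hmeas : ∀ A ∈ 𝒦, MeasurableSet A)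
    (hL : ∀ A ∈ 𝒦, ∀ i, MemLp (X i) 2 (P.restrict (X i ⁻¹' A))) (h : iIndepFun X P) :
    CorrMatrixEqOne P X 𝒦 := by
  intro A hA hpos
  have hmem := fun i => memLp_cond_boxEvent subset_rfl (hL _ (hA i) i) hpos.ne'
  rw [condCorrMatrix_eq_one_iff hpos.ne' hmem]
  intro i j hij
  refine IndepFun.covariance_eq_zero ?_ (hmem i) (hmem j)
  have hbox : boxEvent X A = ⋂ k, X k ⁻¹' A k := by
    ext ω
    simp [boxEvent]
  have hpair : iIndepFun (fun k ω => (X k ω, X k ω)) P :=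
    h.comp (fun _ x => (x, x)) fun _ => by fun_prop
  rw [hbox] at hpos ⊢
  refine (iIndepFun.cond hX hpair (fun k hk => hpos.ne' ?_) fun k => hmeas _ (hA k)).indepFun hij
  exact measure_mono_null (iInter_subset _ k) hk

end Matrix

end

/-! ### Several variables -/

section

variable {Ω : Type*} {n : ℕ} {X : Fin n → Ω → ℝ}

/-- The sides of a box that approximates `{X k ≥ t k for k ∈ S}` from inside as `K` increases
to `ℝ`. -/
def tailSides (K : Set ℝ) (S : Finset (Fin n)) (t : Fin n → ℝ) (k : Fin n) : Set ℝ :=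
  K ∩ {x | k ∈ S → t k ≤ x}

/-- The event `{X k ≥ t k for k ∈ S}`. -/
def tailEvent (X : Fin n → Ω → ℝ) (S : Finset (Fin n)) (t : Fin n → ℝ) : Set Ω :=
  {ω | ∀ k ∈ S, t k ≤ X k ω}

lemma tailSides_of_mem {K : Set ℝ} {S : Finset (Fin n)} {t : Fin n → ℝ} {k : Fin n} (hk : k ∈ S) :
    tailSides K S t k = K ∩ Ici (t k) := by
  ext x
  simp [tailSides, hk]

lemma tailSides_of_notMem {K : Set ℝ} {S : Finset (Fin n)} {t : Fin n → ℝ} {k : Fin n}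
    (hk : k ∉ S) : tailSides K S t k = K := by
  ext x
  simp [tailSides, hk]

lemma measurableSet_tailSides {K : Set ℝ} (hK : MeasurableSet K) (S : Finset (Fin n))
    (t : Fin n → ℝ) (k : Fin n) : MeasurableSet (tailSides K S t k) := by
  by_cases hk : k ∈ S
  · rw [tailSides_of_mem hk]
    exact hK.inter measurableSet_Ici
  · rwa [tailSides_of_notMem hk]

lemma boxEvent_tailSides_insert (K : Set ℝ) (S : Finset (Fin n)) (t : Fin n → ℝ) (i : Fin n) :
    boxEvent X (tailSides K (insert i S) t) =
      boxEvent X (tailSides K S t) ∩ X i ⁻¹' Ici (t i) := by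
  ext ω
  simp only [boxEvent, tailSides, Finset.mem_insert, mem_inter_iff, Set.mem_ofPred_eq, mem_preimage,
    mem_Ici]
  constructor
  · exact fun h => ⟨fun k => ⟨(h k).1, fun hk => (h k).2 (Or.inr hk)⟩, (h i).2 (Or.inl rfl)⟩
  · rintro ⟨h, hi⟩ k
    refine ⟨(h k).1, ?_⟩
    rintro (rfl | hk)
    · exact hi
    · exact (h k).2 hk

lemma tailSides_update_of_notMem {K : Set ℝ} {S : Finset (Fin n)} {t : Fin n → ℝ} {i : Fin n}
    (hi : i ∉ S) (a : ℝ) :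
    tailSides K S (Function.update t i a) = tailSides K S t := by
  funext k
  ext x
  simp only [tailSides, mem_inter_iff, Set.mem_ofPred_eq]
  refine and_congr_right fun _ => forall_congr' fun hk => ?_
  rw [Function.update_of_ne (ne_of_mem_of_not_mem hk hi)]

variable [MeasurableSpace Ω] {P : Measure Ω}

/-- In a box of the form `tailSides K S t`, two coordinates outside `S` have independent tails.
For such a coordinate, cutting the side `K` off at `a` gives a set of the family `𝒦`, or a set with
at most one point, on which the coordinate is constant. -/
lemma box_tail_mul_eq_mul [IsProbabilityMeasure P] (hX : ∀ i, Measurable (X i)) {𝒦 : Set (Set ℝ)}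
    (h : CorrMatrixEqOne P X 𝒦) {K : Set ℝ} (hKm : MeasurableSet K) (hK : K ∈ 𝒦)
    (hL : ∀ i, MemLp (X i) 2 (P.restrict (X i ⁻¹' K)))
    (hcut : ∀ a, K ∩ Ici a ∈ 𝒦 ∨ (K ∩ Ici a).Subsingleton)
    {S : Finset (Fin n)} {t : Fin n → ℝ} (hS : ∀ k ∈ S, K ∩ Ici (t k) ∈ 𝒦)
    {i j : Fin n} (hij : i ≠ j) (hi : i ∉ S) (hj : j ∉ S) :
    P.real (boxEvent X (tailSides K (insert i (insert j S)) t)) *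
        P.real (boxEvent X (tailSides K S t)) =
      P.real (boxEvent X (tailSides K (insert i S) t)) *
        P.real (boxEvent X (tailSides K (insert j S) t)) := by
  set R := boxEvent X (tailSides K S t) with hR
  have hRm : MeasurableSet R := measurableSet_boxEvent hX (measurableSet_tailSides hKm S t)
  have hQ : ∀ a b, boxEvent X (tailSides K (insert i (insert j S))
      (Function.update (Function.update t i a) j b)) = R ∩ (X i ⁻¹' Ici a ∩ X j ⁻¹' Ici b) := by
    intro a b
    rw [boxEvent_tailSides_insert, boxEvent_tailSides_insert, tailSides_update_of_notMem hj,
      tailSides_update_of_notMem hi, Function.update_self, Function.update_of_ne hij,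
      Function.update_self, inter_assoc, inter_comm (X j ⁻¹' _)]
  have hQt := hQ (t i) (t j)
  simp only [Function.update_eq_self] at hQt
  rw [hQt, boxEvent_tailSides_insert, boxEvent_tailSides_insert, ← hR]
  by_cases hR0 : P R = 0
  · have h0 : ∀ B, P.real (R ∩ B) = 0 := fun B => by
      rw [measureReal_def, measure_mono_null inter_subset_left hR0, ENNReal.toReal_zero]
    simp [h0]
  have := cond_isProbabilityMeasure hR0
  have sub : ∀ (S' : Finset (Fin n)) t' k, tailSides K S' t' k ⊆ K := fun _ _ _ =>
    inter_subset_left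
  have hmem : ∀ k, MemLp (X k) 2 (ProbabilityTheory.cond P R) := fun k =>
    memLp_cond_boxEvent (sub S t k) (hL k) hR0
  have key := measureReal_tail_inter_eq_mul (hX i) (hX j) (hmem i) (hmem j) ?_ (t i) (t j)
  · have hreal : ∀ B, (ProbabilityTheory.cond P R).real B = (P.real R)⁻¹ * P.real (R ∩ B) :=
      fun B => by rw [measureReal_def, cond_apply hRm, ENNReal.toReal_mul, ENNReal.toReal_inv]; rfl
    rw [hreal, hreal, hreal] at key
    have hr : P.real R ≠ 0 := by simpa [measureReal_eq_zero_iff] using hR0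
    field_simp at key
    linarith
  · intro a b hab
    have hm : ∀ (Z : Ω → ℝ), Measurable Z → ∀ c, MeasurableSet (Z ⁻¹' Ici c) := fun Z hZ c =>
      hZ measurableSet_Ici
    rw [cond_cond_eq_cond_inter hRm ((hm _ (hX i) a).inter (hm _ (hX j) b)), ← hQ]
    rw [cond_apply hRm, ← hQ, mul_ne_zero_iff] at hab
    replace hab := hab.2
    set t' := Function.update (Function.update t i a) j b with ht'
    set A := tailSides K (insert i (insert j S)) t' with hA
    have hAi : A i = K ∩ Ici a := by
      rw [hA, tailSides_of_mem (by simp), ht', Function.update_of_ne hij, Function.update_self]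
    have hAj : A j = K ∩ Ici b := by
      rw [hA, tailSides_of_mem (by simp), ht', Function.update_self]
    have hAm : MeasurableSet (boxEvent X A) :=
      measurableSet_boxEvent hX (measurableSet_tailSides hKm _ _)
    have := cond_isProbabilityMeasure hab
    have hconst : ∀ {k l}, (A k).Subsingleton →
        cov[X k, X l; ProbabilityTheory.cond P (boxEvent X A)] = 0 := by
      intro k l hk
      obtain ⟨ω₀, hω₀⟩ := nonempty_of_measure_ne_zero hab
      exact covariance_eq_zero_of_ae_const (c := X k ω₀)
        (ae_cond_of_forall_mem hAm fun ω hω => hk (hω k) (hω₀ k))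
    rcases hcut a with ha | ha
    · rcases hcut b with hb | hb
      · refine (condCorrMatrix_eq_one_iff hab fun k =>
          memLp_cond_boxEvent (sub _ _ k) (hL k) hab).1 (h A (fun k => ?_) (pos_iff_ne_zero.2 hab))
          i j hij
        by_cases hki : k = i
        · rwa [hki, hAi]
        by_cases hkj : k = j
        · rwa [hkj, hAj]
        by_cases hkS : k ∈ S
        · rw [hA, tailSides_of_mem (by simp [hkS]), ht', Function.update_of_ne hkj,
            Function.update_of_ne hki]
          exact hS k hkS
        · rwa [hA, tailSides_of_notMem (by simp [hki, hkj, hkS])]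
      · rw [covariance_comm]
        exact hconst (hAj ▸ hb)
    · exact hconst (hAi ▸ ha)

lemma tendsto_measureReal_boxEvent_tailSides [IsFiniteMeasure P] {K : ℕ → Set ℝ}
    (hmono : Monotone K) (hunion : ⋃ N, K N = univ) (S : Finset (Fin n)) (t : Fin n → ℝ) :
    Tendsto (fun N => P.real (boxEvent X (tailSides (K N) S t))) atTop
      (𝓝 (P.real (tailEvent X S t))) := by
  have hu : ⋃ N, boxEvent X (tailSides (K N) S t) = tailEvent X S t := by
    ext ω
    simp only [mem_iUnion, boxEvent, tailSides, tailEvent, Set.mem_ofPred_eq, mem_inter_iff]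
    constructor
    · rintro ⟨N, hN⟩ k hk
      exact (hN k).2 hk
    · intro hω
      have hex : ∀ k, ∃ N, X k ω ∈ K N := fun k => mem_iUnion.1 (hunion ▸ mem_univ (X k ω))
      choose M hM using hex
      exact ⟨Finset.univ.sup M, fun k =>
        ⟨hmono (Finset.le_sup (Finset.mem_univ k)) (hM k), hω k⟩⟩
  rw [← hu]
  exact tendsto_measureReal_iUnion fun M N hMN ω hω k => ⟨hmono hMN (hω k).1, (hω k).2⟩

/-- Identity correlation matrices on a family `𝒦` imply independence, as soon as `𝒦` contains an
exhaustion `K N` of the line whose members can be cut off from the left at any point without leaving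
`𝒦`. A set that is cut off close to its right end may degenerate to a point or to the empty set, but
a fixed cut must not do so for large `N`. -/
theorem CorrMatrixEqOne.iIndepFun [IsProbabilityMeasure P] (hX : ∀ i, Measurable (X i))
    {𝒦 : Set (Set ℝ)} (h : CorrMatrixEqOne P X 𝒦) {K : ℕ → Set ℝ} (hmono : Monotone K)
    (hunion : ⋃ N, K N = univ) (hKm : ∀ N, MeasurableSet (K N)) (hK : ∀ N, K N ∈ 𝒦)
    (hL : ∀ N i, MemLp (X i) 2 (P.restrict (X i ⁻¹' K N)))
    (hcut : ∀ N a, K N ∩ Ici a ∈ 𝒦 ∨ (K N ∩ Ici a).Subsingleton)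
    (hev : ∀ a, ∀ᶠ N in atTop, K N ∩ Ici a ∈ 𝒦) :
    iIndepFun X P := by
  have hlim := fun S t => tendsto_measureReal_boxEvent_tailSides (P := P) (X := X) hmono hunion S t
  have htwo : ∀ (t : Fin n → ℝ) (S : Finset (Fin n)) (i j : Fin n), i ≠ j → i ∉ S → j ∉ S →
      P.real (tailEvent X (insert i (insert j S)) t) * P.real (tailEvent X S t) =
        P.real (tailEvent X (insert i S) t) * P.real (tailEvent X (insert j S) t) := by
    intro t S i j hij hi hj
    refine tendsto_nhds_unique_of_eventuallyEq ((hlim _ t).mul (hlim _ t))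
      ((hlim _ t).mul (hlim _ t)) ?_
    filter_upwards [(Finset.eventually_all S).2 fun k _ => hev (t k)] with N hN
    exact box_tail_mul_eq_mul hX h (hKm N) (hK N) (hL N) (hcut N) hN hij hi hj
  have hempty : ∀ t, P.real (tailEvent X ∅ t) = 1 := fun t => by simp [tailEvent]
  have hsing : ∀ t j, tailEvent X {j} t = X j ⁻¹' Ici (t j) := fun t j => by
    ext ω
    simp [tailEvent]
  -- pairwise conditional independence given `tailEvent X S t` for all `S` gives factorization of
  -- tail events one coordinate at a time
  have hone : ∀ (t : Fin n → ℝ) (S : Finset (Fin n)) (j : Fin n), j ∉ S →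
      P.real (tailEvent X (insert j S) t) =
        P.real (X j ⁻¹' Ici (t j)) * P.real (tailEvent X S t) := by
    intro t S
    induction S using Finset.induction_on with
    | empty =>
      intro j _
      rw [hempty, mul_one, LawfulSingleton.insert_empty_eq, hsing]
    | insert i S hi ih =>
      intro j hj
      rw [Finset.mem_insert, not_or] at hj
      have h2 := htwo t S j i hj.1 hj.2 hi
      rw [ih j hj.2] at h2
      -- the common factor `P.real (tailEvent X S t)` cancels unless all terms vanish
      by_cases h0 : P.real (tailEvent X S t) = 0
      · have hz : ∀ S', S ⊆ S' → P.real (tailEvent X S' t) = 0 := fun S' hS' =>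
          le_antisymm (h0 ▸ measureReal_mono fun ω hω k hk => hω k (hS' hk)) measureReal_nonneg
        rw [hz _ (Finset.subset_insert _ _),
          hz _ ((Finset.subset_insert _ _).trans (Finset.subset_insert _ _)), mul_zero]
      · refine mul_right_cancel₀ h0 (h2.trans ?_)
        ring
  have hprod : ∀ (t : Fin n → ℝ) (S : Finset (Fin n)),
      P.real (tailEvent X S t) = ∏ k ∈ S, P.real (X k ⁻¹' Ici (t k)) := by
    intro t S
    induction S using Finset.induction_on with
    | empty => simp [hempty]
    | insert j S hj ih => rw [hone t S j hj, Finset.prod_insert hj, ih]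
  rw [iIndepFun_iff_iIndep]
  refine iIndepSets.iIndep (fun i => (hX i).comap_le) (fun i => preimage (X i) '' range Ici)
    (fun i => ?_) (fun i => ?_) ?_
  · rintro _ ⟨_, ⟨a, rfl⟩, rfl⟩ _ ⟨_, ⟨b, rfl⟩, rfl⟩ -
    exact ⟨_, ⟨a ⊔ b, rfl⟩, by rw [← preimage_inter, Ici_inter_Ici]⟩
  · rw [← MeasurableSpace.comap_generateFrom, ← borel_eq_generateFrom_Ici ℝ,
      ← BorelSpace.measurable_eq]
  · rw [iIndepSets_iff]
    intro S f hf
    have hf' : ∀ i, ∃ a, i ∈ S → f i = X i ⁻¹' Ici a := by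
      intro i
      by_cases hi : i ∈ S
      · obtain ⟨_, ⟨a, rfl⟩, ha⟩ := hf i hi
        exact ⟨a, fun _ => ha.symm⟩
      · exact ⟨0, fun h => absurd h hi⟩
    choose t ht using hf'
    have hset : ⋂ i ∈ S, f i = tailEvent X S t := by
      rw [iInter₂_congr ht]
      ext ω
      simp [tailEvent]
    rw [hset, Finset.prod_congr rfl fun i hi => congrArg P (ht i hi),
      ← ENNReal.toReal_eq_toReal_iff' (measure_ne_top _ _)
        (ENNReal.prod_ne_top fun _ _ => measure_ne_top _ _), ENNReal.toReal_prod]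
    exact hprod t S

lemma memLp_restrict_preimage_Icc [IsFiniteMeasure P] {Z : Ω → ℝ} (hZ : Measurable Z)
    (a b : ℝ) : MemLp Z 2 (P.restrict (Z ⁻¹' Icc a b)) := by
  refine MemLp.of_bound hZ.aestronglyMeasurable (max |a| |b|) ?_
  filter_upwards [ae_restrict_mem (hZ measurableSet_Icc)] with ω hω
  exact abs_le_max_abs_abs hω.1 hω.2

lemma Icc_inter_Ici_eq (a b c : ℝ) : Icc a b ∩ Ici c = Icc (max a c) b := by
  ext x
  simp only [mem_inter_iff, mem_Icc, mem_Ici, max_le_iff]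
  tauto

end

end CondCorr

theorem theorem2 {Ω : Type*} [MeasurableSpace Ω] (P : Measure Ω) [IsProbabilityMeasure P]
    (n : ℕ) (X : Fin n → Ω → ℝ) (hX : ∀ i, Measurable (X i)) :
    (iIndepFun X P ↔ CondCorr.CorrMatrixEqOne P X CondCorr.boundedIntervals) ∧
    ((∀ i, MemLp (X i) 2 P) →
      (iIndepFun X P ↔ CondCorr.CorrMatrixEqOne P X CondCorr.halfLines)) := by
  refine ⟨⟨fun h => ?_, fun h => ?_⟩, fun h2 => ⟨fun h => ?_, fun h => ?_⟩⟩
  · refine CondCorr.CorrMatrixEqOne.of_iIndepFun hX ?_ ?_ h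
    · rintro _ ⟨a, b, -, rfl⟩
      exact measurableSet_Icc
    · rintro _ ⟨a, b, -, rfl⟩ i
      exact CondCorr.memLp_restrict_preimage_Icc (hX i) a b
  -- `N + 1` instead of `N`, so that the end points are distinct also for `N = 0`
  · refine h.iIndepFun hX (K := fun N => Icc (-(N + 1 : ℝ)) (N + 1)) ?_ ?_
      (fun N => measurableSet_Icc) ?_
      (fun N i => CondCorr.memLp_restrict_preimage_Icc (hX i) _ _) ?_ ?_
    · intro M N hMN
      have : (M : ℝ) ≤ N := Nat.cast_le.2 hMN
      exact Icc_subset_Icc (by linarith) (by linarith)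
    · refine eq_univ_of_forall fun x => ?_
      obtain ⟨N, hN⟩ := exists_nat_ge |x|
      have := abs_le.1 hN
      exact mem_iUnion.2 ⟨N, by linarith, by linarith⟩
    · exact fun N => ⟨_, _, by linarith [N.cast_nonneg (α := ℝ)], rfl⟩
    · intro N a
      rw [CondCorr.Icc_inter_Ici_eq]
      rcases lt_or_ge (max (-(N + 1 : ℝ)) a) (N + 1) with hlt | hge
      · exact Or.inl ⟨_, _, hlt, rfl⟩
      · exact Or.inr (subsingleton_Icc_of_ge hge)
    · intro a
      obtain ⟨M, hM⟩ := exists_nat_ge a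
      filter_upwards [eventually_ge_atTop M] with N hN
      have : (M : ℝ) ≤ N := Nat.cast_le.2 hN
      rw [CondCorr.Icc_inter_Ici_eq]
      exact ⟨_, _, max_lt (by linarith [N.cast_nonneg (α := ℝ)]) (by linarith), rfl⟩
  · refine CondCorr.CorrMatrixEqOne.of_iIndepFun hX ?_ (fun A _ i => (h2 i).restrict _) h
    rintro _ ⟨a, rfl⟩
    exact measurableSet_Ici
  · refine h.iIndepFun hX (K := fun N => Ici (-(N : ℝ))) ?_ ?_
      (fun N => measurableSet_Ici) (fun N => ⟨_, rfl⟩) (fun N i => (h2 i).restrict _) ?_ ?_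
    · exact fun M N hMN => Ici_subset_Ici.2 (neg_le_neg (Nat.cast_le.2 hMN))
    · refine eq_univ_of_forall fun x => ?_
      obtain ⟨N, hN⟩ := exists_nat_ge (-x)
      exact mem_iUnion.2 ⟨N, show -(N : ℝ) ≤ x by linarith⟩
    · exact fun N a => Or.inl ⟨_, Ici_inter_Ici⟩
    · exact fun a => Eventually.of_forall fun N => ⟨_, Ici_inter_Ici⟩
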